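/- For a finite simple graph $G=(V,E)$, let the VC-dimension of $G$ be the largest $k$ for which there are vertices $a_i$ ($i\in[k]$) and $b_S$ ($S\subseteq[k]$) such that $a_ib_S\in E$ if and only if $i\in S$. For nonempty $X,Y\subseteq V$, let $d_G(X,Y)=|\{(x,y)\in X\times Y: xy\in E\}|/(|X||Y|)$, and call the pair $(X,Y)$ $\epsilon$-homogeneous if $d_G(X,Y)\in[0,\epsilon)\cup(1-\epsilon,1]$. A partition $\mathcal P$ of $V$ into nonempty parts is an equipartition if the sizes of any two parts differ by at most $1$, and it is $\epsilon$-homogeneous for $G$ if at least $(1-\epsilon)|V|^2$ of the ordered pairs $(x,y)\in V^2$ lie in $X\times Y$ for some $\epsilon$-homogeneous pair $(X,Y)\in\mathcal P^2$. **Theorem.** For every integer $k\ge 1$ there is a constant $C=C(k)>0$ such that the following holds for all $\epsilon\in(0,1/4)$. Let $H=(A\cup B,E)$ be a finite bipartite graph with parts $A$ and $B$, with VC-dimension less than $k$, with $|A|=|B|$ and with $|A|+|B|\ge\epsilon^{-1}$. Then there is an equipartition $\mathcal P$ of $A\cup B$ refining $\{A,B\}$ which is $\epsilon$-homogeneous for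 $H$ and satisfies $\epsilon^{-1}\le|\mathcal P|\le C\epsilon^{-(2k+2)}$. -/

import Mathlib

namespace SimpleGraph

/-- There are vertices `a i` (`i ∈ [k]`) and `b S` (`S ⊆ [k]`) such that `a i` is adjacent to `b S`
if and only if `i ∈ S`. -/
def HasShatteredSet {V : Type*} (G : SimpleGraph V) (k : ℕ) : Prop :=
  ∃ (a : Fin k → V) (b : Finset (Fin k) → V), ∀ i S, G.Adj (a i) (b S) ↔ i ∈ S

/-- The VC-dimension of a graph, i.e. the largest `k` such that `G.HasShatteredSet k`. It takes values
in `ℕ∞`, so that no junk value arises for an infinite graph. -/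
noncomputable def vcDimension {V : Type*} (G : SimpleGraph V) : ℕ∞ :=
  ⨆ (k : ℕ) (_ : G.HasShatteredSet k), (k : ℕ∞)

/-- The pair `(X, Y)` is `ε`-homogeneous: its edge density lies in `[0, ε) ∪ (1 - ε, 1]`. -/
def IsHomogeneousPair {V : Type*} (G : SimpleGraph V) [DecidableRel G.Adj] (ε : ℝ)
    (X Y : Finset V) : Prop :=
  (G.edgeDensity X Y : ℝ) ∈ Set.Ico 0 ε ∪ Set.Ioc (1 - ε) 1

/-- The partition `P` of the vertex set is `ε`-homogeneous: at least `(1 - ε)|V|²` of the ordered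
pairs `(x, y)` of vertices lie in `X × Y` for some `ε`-homogeneous pair `(X, Y)` of parts. -/
def IsHomogeneousPartition {V : Type*} [Fintype V] [DecidableEq V] (G : SimpleGraph V)
    [DecidableRel G.Adj] (ε : ℝ) (P : Finpartition (Finset.univ : Finset V)) : Prop :=
  (1 - ε) * (Fintype.card V : ℝ) ^ 2 ≤
    (Set.ncard {p : V × V | ∃ X ∈ P.parts, ∃ Y ∈ P.parts,
      G.IsHomogeneousPair ε X Y ∧ p.1 ∈ X ∧ p.2 ∈ Y} : ℝ)

end SimpleGraph

/-! ### Greedy hitting sets. -/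

open Finset

/-! Put δ = ε²/2. Vertices of one side whose neighbourhoods pairwise differ on δ|B| vertices are
told apart by O(log N/δ) well-chosen vertices of B, N being their number. Sauer-Shelah bounds the
number of traces on so small a set, and absorbing the logarithm gives N ≤ (c/δ)^k
(`card_le_of_pairwise_le_nbhdDist`). Balls around a maximal separated set then give few clusters of
diameter 2δ|B|; cutting them into about (c/δ)^k/δ equal parts leaves only a proportion δ of the
vertices in parts that straddle clusters.

Homogeneity follows by averaging. If X × Y has density d, two random pairs in it differ in adjacency
with probability 2d(1-d). Changing one coordinate at a time bounds this by the spreads of X and Y.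
The spreads add up over parts to O(δ|A||B|), while an inhomogeneous pair costs about ε|X||Y|, so
inhomogeneous pairs have total size O(ε|A||B|). The part count δ^(-k-1) becomes ε^(-2k-2). -/

/-- If every element of `U` is hit by at least a proportion `c` of `B`, then some `m` elements of
`B` hit all but a proportion `(1 - c) ^ m` of `U`. -/
theorem Finset.exists_subset_card_not_hit_le {α β : Type*} [DecidableEq β] (r : α → β → Prop)
    [∀ p y, Decidable (r p y)] (U : Finset α) {B : Finset β} (hB : B.Nonempty) {c : ℝ} (hc : c ≤ 1)
    (h : ∀ p ∈ U, c * #B ≤ #{y ∈ B | r p y}) (m : ℕ) :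
    ∃ T ⊆ B, #T ≤ m ∧ (#{p ∈ U | ∀ y ∈ T, ¬ r p y} : ℝ) ≤ (1 - c) ^ m * #U := by
  induction m with
  | zero => exact ⟨∅, by simp⟩
  | succ m ih =>
    obtain ⟨T, hTB, hTm, hT⟩ := ih
    set W := {p ∈ U | ∀ y ∈ T, ¬ r p y} with hW
    -- Double counting: the average element of `B` hits a proportion `c` of what is still unhit.
    obtain ⟨y, hy, hcy⟩ : ∃ y ∈ B, c * #W ≤ (#{p ∈ W | r p y} : ℝ) := by
      apply exists_le_of_sum_le hB
      have hcount : ∑ y ∈ B, (#{p ∈ W | r p y} : ℝ) = ∑ p ∈ W, (#{y ∈ B | r p y} : ℝ) := by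
        exact_mod_cast (sum_card_bipartiteAbove_eq_sum_card_bipartiteBelow r (s := W) (t := B)).symm
      rw [hcount, sum_const, nsmul_eq_mul]
      calc (#B : ℝ) * (c * #W) = ∑ p ∈ W, c * (#B : ℝ) := by
            rw [sum_const, nsmul_eq_mul]; ring
        _ ≤ _ := sum_le_sum fun p hp => h p (mem_filter.1 hp).1
    refine ⟨insert y T, insert_subset hy hTB, (card_insert_le _ _).trans (by omega), ?_⟩
    have heq : {p ∈ U | ∀ z ∈ insert y T, ¬ r p z} = {p ∈ W | ¬ r p y} := by
      ext p
      simp only [hW, mem_filter, forall_mem_insert]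
      tauto
    have hadd : (#{p ∈ W | r p y} : ℝ) + #{p ∈ W | ¬ r p y} = #W := by
      exact_mod_cast card_filter_add_card_filter_not (s := W) (fun p => r p y)
    rw [heq, pow_succ]
    nlinarith [mul_le_mul_of_nonneg_left hT (sub_nonneg.2 hc)]

/-! ### Traces, Sauer-Shelah and the packing bound. -/

namespace SimpleGraph

variable {V : Type*}

theorem not_hasShatteredSet_of_vcDimension_lt {k : ℕ} {G : SimpleGraph V} (h : G.vcDimension < k) :
    ¬ G.HasShatteredSet k := fun hs =>
  h.not_ge (le_iSup₂ (f := fun (k : ℕ) (_ : G.HasShatteredSet k) => (k : ℕ∞)) k hs)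

variable (G : SimpleGraph V) [DecidableRel G.Adj]

/-- The number of vertices in `B` that are adjacent to exactly one of two given vertices. -/
def nbhdDist (B : Finset V) (x x' : V) : ℕ := #{y ∈ B | ¬(G.Adj x y ↔ G.Adj x' y)}

variable {G}

theorem nbhdDist_self (B : Finset V) (x : V) : G.nbhdDist B x x = 0 := by
  simp [nbhdDist]

theorem nbhdDist_comm (B : Finset V) (x x' : V) : G.nbhdDist B x x' = G.nbhdDist B x' x := by
  simp [nbhdDist, iff_comm]

theorem nbhdDist_le_card (B : Finset V) (x x' : V) : G.nbhdDist B x x' ≤ #B :=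
  card_filter_le _ _

variable [DecidableEq V]

theorem nbhdDist_triangle (B : Finset V) (x y z : V) :
    G.nbhdDist B x z ≤ G.nbhdDist B x y + G.nbhdDist B y z := by
  refine (card_le_card fun w hw => ?_).trans (card_union_le _ _)
  simp only [mem_union, mem_filter] at hw ⊢
  tauto

/-- A Sauer-Shelah bound: without a shattered set of size `k`, the vertices have few traces. -/
theorem card_le_sum_choose_of_injOn_trace {k : ℕ} (hk : ¬ G.HasShatteredSet k) {S T : Finset V}
    (hinj : Set.InjOn (fun x => {y ∈ T | G.Adj x y}) (S : Set V)) :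
    #S ≤ ∑ i ∈ range k, (#T).choose i := by
  set F := S.image fun x => {y ∈ T | G.Adj x y} with hF
  rw [← card_image_of_injOn hinj]
  refine (card_le_card_shatterer F).trans ?_
  have hsub : F.shatterer ⊆ (range k).biUnion fun i => T.powersetCard i := by
    intro s hs
    rw [mem_shatterer] at hs
    obtain ⟨u, hu, hsu⟩ := hs.exists_superset
    simp only [hF, mem_image] at hu
    obtain ⟨x, -, rfl⟩ := hu
    simp only [mem_biUnion, mem_range, mem_powersetCard]
    refine ⟨#s, ?_, hsu.trans (filter_subset _ _), rfl⟩
    by_contra! hks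
    obtain ⟨t, hts, htk⟩ := exists_subset_card_eq hks
    let e : Fin k ≃ t := (t.equivFinOfCardEq htk).symm
    -- The shattered points `e i` lie in `T`; the vertex whose trace cuts out `R` serves as `b R`,
    -- by symmetry of adjacency.
    have hb : ∀ R : Finset (Fin k), ∃ x, ∀ i, G.Adj (e i) x ↔ i ∈ R := by
      intro R
      obtain ⟨u, hu, hRu⟩ := hs (t := R.image fun i => (e i : V)) (by
        intro v hv
        obtain ⟨i, -, rfl⟩ := mem_image.1 hv
        exact hts (e i).2)
      simp only [hF, mem_image] at hu
      obtain ⟨x, -, rfl⟩ := hu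
      refine ⟨x, fun i => ?_⟩
      have hi := Finset.ext_iff.1 hRu (e i)
      have his : (e i : V) ∈ s := hts (e i).2
      have hiT : (e i : V) ∈ T := (mem_filter.1 (hsu his)).1
      simp only [mem_inter, his, mem_filter, hiT, true_and, mem_image, Subtype.val_inj,
        e.injective.eq_iff, exists_eq_right] at hi
      rw [G.adj_comm, hi]
    choose b hb using hb
    exact hk ⟨fun i => e i, b, fun i R => hb R i⟩
  refine (card_le_card hsub).trans (card_biUnion_le.trans_eq ?_)
  simp

/-- The constant in the bound on the number of vertices with pairwise distant neighborhoods. -/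
def packingConst (k : ℕ) : ℝ := k * (2 * k ^ 2 + 1) ^ (k - 1)

theorem one_le_packingConst {k : ℕ} (hk : 1 ≤ k) : 1 ≤ packingConst k := by
  have h1 : (1 : ℝ) ≤ k := by exact_mod_cast hk
  have h2 : (1 : ℝ) ≤ (2 * k ^ 2 + 1) ^ (k - 1) := one_le_pow₀ (by nlinarith)
  unfold packingConst
  nlinarith

theorem sum_choose_le_mul_pow {k m : ℕ} (hm : 1 ≤ m) :
    ∑ i ∈ range k, m.choose i ≤ k * m ^ (k - 1) := by
  calc _ ≤ ∑ i ∈ range k, m ^ (k - 1) := sum_le_sum fun i hi =>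
        (Nat.choose_le_pow m i).trans (Nat.pow_le_pow_right hm (by have := mem_range.1 hi; omega))
    _ = _ := by simp

/-- The logarithm costs one extra power of 1/δ. With w = N^(1/k²), log N ≤ k²w, so w^(k²) is at most
a constant times (w/δ)^(k-1). Since k² - (k-1) ≥ k(k-1), cancelling w^(k-1) and taking a (k-1)-st
root bounds w^k. That root needs k ≥ 2. -/
theorem le_pow_of_log_bound {k : ℕ} (hk : 1 ≤ k) {N m δ : ℝ} (hN : 1 ≤ N) (hδ : 0 < δ)
    (hδ1 : δ ≤ 1) (hm0 : 0 ≤ m) (hm : m ≤ 2 * Real.log N / δ + 1) (h : N ≤ k * m ^ (k - 1)) :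
    N ≤ (packingConst k / δ) ^ k := by
  obtain rfl | hk2 := hk.eq_or_lt
  · simp only [packingConst] at h ⊢
    norm_num at h ⊢
    exact h.trans ((one_le_inv₀ hδ).2 hδ1)
  have hk0 : (1 : ℝ) ≤ k := by exact_mod_cast hk
  set w := N ^ ((k ^ 2 : ℕ) : ℝ)⁻¹ with hw
  have hwN : w ^ (k ^ 2) = N := Real.rpow_inv_natCast_pow (by linarith) (by positivity)
  have hw1 : 1 ≤ w := Real.one_le_rpow hN (by positivity)
  have hlog : Real.log N ≤ k ^ 2 * w := by
    rw [← hwN, Real.log_pow]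
    push_cast
    gcongr
    exact (Real.log_le_sub_one_of_pos (by linarith)).trans (by linarith)
  have hmw : m ≤ (2 * k ^ 2 + 1) * (w / δ) := by
    have h1 : 1 ≤ w / δ := (one_le_div hδ).2 (hδ1.trans hw1)
    calc m ≤ 2 * Real.log N / δ + 1 := hm
      _ ≤ 2 * (k ^ 2 * w) / δ + w / δ := by gcongr
      _ = _ := by ring
  have h2 : w ^ (k ^ 2) ≤ packingConst k * (w / δ) ^ (k - 1) := by
    rw [hwN, packingConst, mul_assoc, ← mul_pow]
    exact h.trans (by gcongr)
  have h3 : (w ^ k) ^ (k - 1) ≤ (packingConst k / δ) ^ (k - 1) := by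
    have hpc := one_le_packingConst hk
    have hpow : packingConst k ≤ packingConst k ^ (k - 1) :=
      le_self_pow₀ hpc (by omega)
    have h4 : (w ^ k) ^ (k - 1) * w ^ (k - 1) ≤ w ^ (k ^ 2) := by
      rw [← pow_mul, ← pow_add]
      refine pow_le_pow_right₀ hw1 ?_
      obtain ⟨j, rfl⟩ : ∃ j, k = j + 1 := ⟨k - 1, by omega⟩
      simp only [Nat.add_sub_cancel]
      nlinarith
    have h5 : (0 : ℝ) < w ^ (k - 1) := by positivity
    refine le_of_mul_le_mul_right ?_ h5
    calc _ ≤ packingConst k * (w / δ) ^ (k - 1) := h4.trans h2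
      _ ≤ packingConst k ^ (k - 1) * (w / δ) ^ (k - 1) := by gcongr
      _ = _ := by rw [← mul_pow, ← mul_pow]; ring
  have h6 : w ^ k ≤ packingConst k / δ :=
    le_of_pow_le_pow_left₀ (by omega) (by have := one_le_packingConst hk; positivity) h3
  calc N = (w ^ k) ^ k := by rw [← hwN, ← pow_mul, sq]
    _ ≤ _ := by gcongr

/-- Without a shattered set of size `k`, few vertices have pairwise distant neighborhoods. -/
theorem card_le_of_pairwise_le_nbhdDist {k : ℕ} (hk : 1 ≤ k) (hG : ¬ G.HasShatteredSet k)
    {S B : Finset V} (hB : B.Nonempty) {δ : ℝ} (hδ : 0 < δ) (hδ1 : δ ≤ 1)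
    (hS : ∀ x ∈ S, ∀ x' ∈ S, x ≠ x' → δ * #B ≤ G.nbhdDist B x x') :
    (#S : ℝ) ≤ (packingConst k / δ) ^ k := by
  obtain rfl | hne := S.eq_empty_or_nonempty
  · have := one_le_packingConst hk
    simp only [card_empty, Nat.cast_zero]
    positivity
  have hN : (1 : ℝ) ≤ #S := by exact_mod_cast hne.card_pos
  -- Makes δm > 2 log |S|, so fewer than (1-δ)^m |S|² < 1 pairs, hence none, remain undistinguished.
  set m := ⌊2 * Real.log #S / δ⌋₊ + 1 with hm
  have hlog : 0 ≤ Real.log #S := Real.log_nonneg hN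
  obtain ⟨T, hTB, hTm, hT⟩ := exists_subset_card_not_hit_le
    (fun (p : V × V) y => ¬(G.Adj p.1 y ↔ G.Adj p.2 y)) S.offDiag hB hδ1
    (fun p hp => by
      rw [mem_offDiag] at hp
      exact hS _ hp.1 _ hp.2.1 hp.2.2) m
  have hlt : (1 - δ) ^ m * (#S.offDiag : ℝ) < 1 := by
    have h1 : (1 - δ) ^ m ≤ Real.exp (-(δ * m)) := by
      calc (1 - δ) ^ m ≤ Real.exp (-δ) ^ m :=
            pow_le_pow_left₀ (by linarith) (by have := Real.add_one_le_exp (-δ); linarith) _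
        _ = _ := by rw [← Real.exp_nat_mul]; ring_nf
    have h2 : 2 * Real.log #S < δ * m := by
      have := Nat.lt_floor_add_one (2 * Real.log #S / δ)
      rw [div_lt_iff₀ hδ] at this
      rw [hm]
      push_cast
      linarith
    have h3 : (#S.offDiag : ℝ) ≤ #S ^ 2 := by
      rw [offDiag_card]
      have : #S * #S - #S ≤ #S ^ 2 := by rw [sq]; exact Nat.sub_le _ _
      exact_mod_cast this
    have h4 : (#S : ℝ) ^ 2 = Real.exp (2 * Real.log #S) := by
      rw [two_mul, Real.exp_add, Real.exp_log (by linarith), sq]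
    calc _ ≤ Real.exp (-(δ * m)) * Real.exp (2 * Real.log #S) := by
          rw [← h4]; gcongr
      _ < 1 := by rw [← Real.exp_add, Real.exp_lt_one_iff]; linarith
  have hempty : {p ∈ S.offDiag | ∀ y ∈ T, ¬¬(G.Adj p.1 y ↔ G.Adj p.2 y)} = ∅ := by
    rw [← card_eq_zero]
    have := hT.trans_lt hlt
    exact Nat.lt_one_iff.1 (by exact_mod_cast this)
  have hinj : Set.InjOn (fun x => {y ∈ T | G.Adj x y}) (S : Set V) := by
    intro x hx x' hx' hxx'
    by_contra hne
    have : (x, x') ∈ ({p ∈ S.offDiag | ∀ y ∈ T, ¬¬(G.Adj p.1 y ↔ G.Adj p.2 y)} : Finset _) := by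
      simp only [mem_filter, mem_offDiag, not_not]
      refine ⟨⟨hx, hx', hne⟩, fun y hy => ?_⟩
      simpa [hy] using Finset.ext_iff.1 hxx' y
    rw [hempty] at this
    exact notMem_empty _ this
  have hcard : #S ≤ k * m ^ (k - 1) :=
    (card_le_sum_choose_of_injOn_trace hG hinj).trans <|
      (sum_le_sum fun i _ => Nat.choose_le_choose i hTm).trans (sum_choose_le_mul_pow (by omega))
  refine le_pow_of_log_bound hk (m := m) hN hδ hδ1 (by positivity) ?_ (by exact_mod_cast hcard)
  rw [hm]
  push_cast
  gcongr
  exact Nat.floor_le (by positivity)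

end SimpleGraph

/-! ### Clusters and equipartitions of small spread. -/

namespace SimpleGraph

variable {V : Type*} {G : SimpleGraph V} [DecidableRel G.Adj]

/-- The total of `nbhdDist B` over the ordered pairs of vertices in `X`, divided by the size of
`X`. -/
noncomputable def nbhdSpread (G : SimpleGraph V) [DecidableRel G.Adj] (B : Finset V)
    (X : Finset V) : ℝ :=
  (∑ x ∈ X, ∑ x' ∈ X, (G.nbhdDist B x x' : ℝ)) / #X

theorem nbhdSpread_le {B X : Finset V} {D : ℝ} (hD : 0 ≤ D)
    (h : ∀ x ∈ X, ∀ x' ∈ X, (G.nbhdDist B x x' : ℝ) ≤ D) : G.nbhdSpread B X ≤ D * #X := by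
  refine div_le_of_le_mul₀ (by positivity) (by positivity) ?_
  calc _ ≤ ∑ x ∈ X, ∑ x' ∈ X, D := sum_le_sum fun x hx => sum_le_sum fun x' hx' => h x hx x' hx'
    _ = _ := by simp only [sum_const, nsmul_eq_mul]; ring

variable [DecidableEq V]

/-- Without a shattered set of size `k`, the vertices of `A` can be partitioned into few clusters
of vertices with similar neighborhoods in `B`. -/
theorem exists_finpartition_nbhdDist_le {k : ℕ} (hk : 1 ≤ k) (hG : ¬ G.HasShatteredSet k)
    (A : Finset V) {B : Finset V} (hB : B.Nonempty) {δ : ℝ} (hδ : 0 < δ) (hδ1 : δ ≤ 1) :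
    ∃ P : Finpartition A, (#P.parts : ℝ) ≤ (packingConst k / δ) ^ k ∧
      ∀ u ∈ P.parts, ∀ x ∈ u, ∀ x' ∈ u, (G.nbhdDist B x x' : ℝ) ≤ 2 * δ * #B := by
  classical
  -- By maximality every vertex of `A` is within δ|B| of some centre in `S`; the clusters are the
  -- fibres of a choice of centre.
  obtain ⟨S, hS, hmax⟩ := exists_max_image
    {S ∈ A.powerset | ∀ x ∈ S, ∀ x' ∈ S, x ≠ x' → δ * (#B : ℝ) ≤ G.nbhdDist B x x'} card
    ⟨∅, by simp⟩
  simp only [mem_filter, mem_powerset] at hS hmax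
  obtain ⟨hSA, hS⟩ := hS
  have hBpos : (0 : ℝ) < #B := by exact_mod_cast hB.card_pos
  have hc : ∀ x, ∃ c, x ∈ A → c ∈ S ∧ (G.nbhdDist B x c : ℝ) ≤ δ * #B := by
    intro x
    by_cases hxA : x ∈ A
    swap
    · exact ⟨x, fun h => absurd h hxA⟩
    by_contra! hfar
    have hfar : ∀ c ∈ S, δ * (#B : ℝ) < G.nbhdDist B x c := fun c hcS => (hfar c).2 hcS
    have hxS : x ∉ S := fun hxS => by
      have := hfar x hxS
      rw [nbhdDist_self] at this
      push_cast at this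
      nlinarith
    have := hmax (insert x S) ⟨insert_subset hxA hSA, by
      intro y hy z hz hyz
      rw [mem_insert] at hy hz
      obtain rfl | hy := hy
      · obtain rfl | hz := hz
        · exact absurd rfl hyz
        · exact (hfar z hz).le
      · obtain rfl | hz := hz
        · rw [nbhdDist_comm]
          exact (hfar y hy).le
        · exact hS y hy z hz hyz⟩
    rw [card_insert_of_notMem hxS] at this
    omega
  choose c hc using hc
  refine ⟨Finpartition.ofSetSetoid (Setoid.ker c) A, ?_, ?_⟩
  · refine le_trans ?_ (card_le_of_pairwise_le_nbhdDist hk hG hB hδ hδ1 hS)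
    have himage : (Finpartition.ofSetSetoid (Setoid.ker c) A).parts
        ⊆ S.image fun s => {b ∈ A | s = c b} := by
      intro u hu
      obtain ⟨a, ha, rfl⟩ := mem_image.1 hu
      exact mem_image.2 ⟨c a, (hc a ha).1, by simp⟩
    exact_mod_cast (card_le_card himage).trans card_image_le
  · intro u hu x hx x' hx'
    obtain ⟨a, ha, rfl⟩ := mem_image.1 hu
    rw [mem_filter] at hx hx'
    have hcc : c x = c x' := hx.2.symm.trans hx'.2
    have h1 := (hc x hx.1).2
    have h2 := (hc x' hx'.1).2
    rw [← hcc] at h2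
    have h3 := nbhdDist_triangle (G := G) B x (c x) x'
    rw [nbhdDist_comm B (c x) x'] at h3
    have h4 : (G.nbhdDist B x x' : ℝ) ≤ G.nbhdDist B x (c x) + G.nbhdDist B x' (c x) := by
      exact_mod_cast h3
    linarith

/-- A partition into clusters can be turned into an equipartition with small total spread. -/
theorem exists_equitable_sum_nbhdSpread_le {A B : Finset V} (P : Finpartition A) {D : ℝ}
    (hD : 0 ≤ D) (hP : ∀ u ∈ P.parts, ∀ x ∈ u, ∀ x' ∈ u, (G.nbhdDist B x x' : ℝ) ≤ D)
    {t : ℕ} (ht : t ≠ 0) (htA : t ≤ #A) :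
    ∃ Q : Finpartition A, #Q.parts = t ∧ (∀ X ∈ Q.parts, #X = #A / t ∨ #X = #A / t + 1) ∧
      ∑ X ∈ Q.parts, G.nbhdSpread B X ≤ D * #A + #P.parts * (#A / t : ℕ) * #B := by
  classical
  have hlt : #A % t < t := Nat.mod_lt _ (Nat.pos_of_ne_zero ht)
  have hsum : (t - #A % t) * (#A / t) + #A % t * (#A / t + 1) = #A := by
    rw [tsub_mul, mul_add, ← add_assoc,
      tsub_add_cancel_of_le (Nat.mul_le_mul_right _ hlt.le), mul_one, add_comm, Nat.mod_add_div]
  have hm : #A / t ≠ 0 := (Nat.div_pos htA (Nat.pos_of_ne_zero ht)).ne'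
  set Q := P.equitabilise hsum with hQ
  refine ⟨Q, ?_, fun X hX => Finpartition.card_eq_of_mem_parts_equitabilise hX, ?_⟩
  · rw [hQ, P.card_parts_equitabilise hsum hm]
    omega
  -- Parts inside a cluster have spread at most D|X|; the others get the trivial bound. Each cluster
  -- leaves at most |A|/t vertices outside the parts it contains.
  have hterm : ∀ X ∈ Q.parts, G.nbhdSpread B X ≤
      D * #X + if ∃ u ∈ P.parts, X ⊆ u then 0 else (#X : ℝ) * #B := by
    intro X hX
    split_ifs with h
    · obtain ⟨u, hu, hXu⟩ := h
      rw [add_zero]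
      exact nbhdSpread_le hD fun x hx x' hx' => hP u hu x (hXu hx) x' (hXu hx')
    · have : G.nbhdSpread B X ≤ #B * #X := nbhdSpread_le (by positivity) fun x _ x' _ => by
        exact_mod_cast nbhdDist_le_card B x x'
      have : 0 ≤ D * #X := by positivity
      linarith
  refine (sum_le_sum hterm).trans ?_
  rw [sum_add_distrib, ← mul_sum, ← Nat.cast_sum, Q.sum_card_parts]
  gcongr
  rw [sum_ite, sum_const_zero, zero_add, ← sum_mul, ← Nat.cast_sum]
  gcongr
  have hbad : ∑ X ∈ Q.parts with ¬∃ u ∈ P.parts, X ⊆ u, #X ≤ #P.parts * (#A / t) := by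
    refine (card_biUnion (t := id) fun X hX Y hY hXY =>
      Q.disjoint (mem_filter.1 hX).1 (mem_filter.1 hY).1 hXY).symm.trans_le ?_
    have hsub : ({X ∈ Q.parts | ¬∃ u ∈ P.parts, X ⊆ u}.biUnion id) ⊆
        P.parts.biUnion fun u => u \ {y ∈ Q.parts | y ⊆ u}.biUnion id := by
      intro x hx
      simp only [mem_biUnion, mem_filter, id] at hx
      obtain ⟨X, ⟨hX, hXu⟩, hxX⟩ := hx
      obtain ⟨u, hu, hxu⟩ := P.exists_mem (Q.subset hX hxX)
      simp only [mem_biUnion, mem_sdiff, mem_filter, id]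
      refine ⟨u, hu, hxu, ?_⟩
      rintro ⟨Y, ⟨hY, hYu⟩, hxY⟩
      rw [Q.eq_of_mem_parts hY hX hxY hxX] at hYu
      exact hXu ⟨u, hu, hYu⟩
    exact (card_le_card hsub).trans
      (card_biUnion_le_card_mul _ _ _ fun u hu => P.card_parts_equitabilise_subset_le hsum hu)
  exact_mod_cast hbad

/-- Cluster diameter contributes 2δ, and `t` exceeds the number of clusters by a factor 1/δ, so
straddling parts contribute δ. If |A| ≤ t, singletons have zero spread. -/
theorem exists_equitable_min_sum_nbhdSpread_le {k : ℕ} (hk : 1 ≤ k) (hG : ¬ G.HasShatteredSet k)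
    {A B : Finset V} (hA : A.Nonempty) (hB : B.Nonempty) {δ : ℝ} (hδ : 0 < δ) (hδ1 : δ ≤ 1) {t : ℕ}
    (ht : (packingConst k / δ) ^ k / δ ≤ t) :
    ∃ Q : Finpartition A, #Q.parts = min t #A ∧
      (∀ X ∈ Q.parts, #X = #A / min t #A ∨ #X = #A / min t #A + 1) ∧
      ∑ X ∈ Q.parts, G.nbhdSpread B X ≤ 3 * δ * #A * #B := by
  obtain hAt | htA := le_total #A t
  · refine ⟨⊥, ?_, ?_, ?_⟩
    · rw [Finpartition.card_bot, min_eq_right hAt]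
    · intro X hX
      obtain ⟨a, -, rfl⟩ := Finpartition.mem_bot_iff.1 hX
      left
      rw [min_eq_right hAt, Nat.div_self hA.card_pos, card_singleton]
    · refine (sum_nonpos fun X hX => ?_).trans (by positivity)
      obtain ⟨a, -, rfl⟩ := Finpartition.mem_bot_iff.1 hX
      simp [nbhdSpread, nbhdDist_self]
  · have hpc := one_le_packingConst hk
    have htpos : (0 : ℝ) < t := lt_of_lt_of_le (by positivity) ht
    have ht0 : t ≠ 0 := by rintro rfl; simp at htpos
    obtain ⟨P, hPcard, hP⟩ := exists_finpartition_nbhdDist_le hk hG A hB hδ hδ1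
    obtain ⟨Q, hQcard, hQ, hsum⟩ :=
      exists_equitable_sum_nbhdSpread_le (G := G) P (D := 2 * δ * #B) (by positivity) hP ht0 htA
    rw [min_eq_left htA]
    refine ⟨Q, hQcard, hQ, hsum.trans ?_⟩
    have h1 : (#P.parts : ℝ) * (#A / t : ℕ) ≤ δ * #A := by
      calc (#P.parts : ℝ) * (#A / t : ℕ) ≤ (δ * t) * (#A / t) := by
            gcongr
            · rw [div_le_iff₀ hδ] at ht
              linarith
            · exact Nat.cast_div_le
        _ = _ := by field_simp
    have h2 := mul_le_mul_of_nonneg_right h1 (Nat.cast_nonneg (α := ℝ) #B)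
    linarith

end SimpleGraph

/-! ### Edge density, spread and homogeneity. -/

/-- The partition of a disjoint union that consists of the parts of two given partitions. -/
def Finpartition.disjUnion {α : Type*} [DecidableEq α] {s t u : Finset α} (P : Finpartition s)
    (Q : Finpartition t) (hst : Disjoint s t) (hu : s ∪ t = u) : Finpartition u where
  parts := P.parts ∪ Q.parts
  supIndep := by
    rw [supIndep_iff_pairwiseDisjoint, coe_union, Set.pairwiseDisjoint_union]
    exact ⟨P.disjoint, Q.disjoint, fun X hX Y hY _ => hst.mono (P.le hX) (Q.le hY)⟩
  sup_parts := by rw [sup_union, P.sup_parts, Q.sup_parts, ← hu, sup_eq_union]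
  bot_notMem := by
    rw [mem_union, not_or]
    exact ⟨P.bot_notMem, Q.bot_notMem⟩

theorem Finpartition.card_parts_disjUnion {α : Type*} [DecidableEq α] {s t u : Finset α}
    (P : Finpartition s) (Q : Finpartition t) (hst : Disjoint s t) (hu : s ∪ t = u) :
    #(P.disjUnion Q hst hu).parts = #P.parts + #Q.parts := by
  refine card_union_of_disjoint (disjoint_left.2 fun X hX hX' => P.ne_bot hX ?_)
  exact disjoint_self.1 (hst.mono (P.le hX) (Q.le hX'))

namespace SimpleGraph

variable {V : Type*} {G : SimpleGraph V} [DecidableRel G.Adj]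

theorem nbhdDist_eq_sum_abs (Y : Finset V) (x x' : V) : (G.nbhdDist Y x x' : ℝ) =
    ∑ y ∈ Y, |(if G.Adj x y then (1 : ℝ) else 0) - if G.Adj x' y then 1 else 0| := by
  rw [nbhdDist, card_filter, Nat.cast_sum]
  refine sum_congr rfl fun y _ => ?_
  by_cases h : G.Adj x y <;> by_cases h' : G.Adj x' y <;> simp [h, h']

theorem edgeDensity_mul_card_mul_card {X Y : Finset V} (hX : X.Nonempty) (hY : Y.Nonempty) :
    (G.edgeDensity X Y : ℝ) * (#X * #Y) =
      ∑ x ∈ X, ∑ y ∈ Y, if G.Adj x y then (1 : ℝ) else 0 := by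
  have hX' : (#X : ℝ) ≠ 0 := by exact_mod_cast hX.card_pos.ne'
  have hY' : (#Y : ℝ) ≠ 0 := by exact_mod_cast hY.card_pos.ne'
  rw [edgeDensity_def, ← sum_product', interedges_def, card_filter]
  push_cast [apply_ite]
  field_simp

/-- The probability that two random pairs in `X × Y` differ in adjacency is controlled by the
spreads of `X` and `Y`. -/
theorem edgeDensity_mul_one_sub_le_nbhdSpread {X Y : Finset V} (hX : X.Nonempty)
    (hY : Y.Nonempty) :
    2 * G.edgeDensity X Y * (1 - G.edgeDensity X Y) * (#X * #Y) ≤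
      G.nbhdSpread Y X + G.nbhdSpread X Y := by
  have hX' : (0 : ℝ) < #X := by exact_mod_cast hX.card_pos
  have hY' : (0 : ℝ) < #Y := by exact_mod_cast hY.card_pos
  set f : V → V → ℝ := fun x y => if G.Adj x y then (1 : ℝ) else 0 with hf
  have hfsymm : ∀ x y, f x y = f y x := fun x y => by simp only [hf, G.adj_comm]
  have hf01 : ∀ x y, f x y = 0 ∨ f x y = 1 := fun x y => by
    by_cases h : G.Adj x y <;> simp [hf, h]
  have he := edgeDensity_mul_card_mul_card (G := G) hX hY
  set d : ℝ := (G.edgeDensity X Y : ℝ)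
  -- For values in {0, 1}, |a - b| = a + b - 2ab. The triangle inequality through f(x', y) then
  -- compares `hleft` with `hright`.
  have hleft : ∑ x ∈ X, ∑ x' ∈ X, ∑ y ∈ Y, ∑ y' ∈ Y, |f x y - f x' y'| =
      2 * d * (1 - d) * (#X * #Y) * (#X * #Y) := by
    have habs : ∀ x x' y y', |f x y - f x' y'| = f x y + f x' y' - 2 * (f x y * f x' y') := by
      intro x x' y y'
      rcases hf01 x y with h | h <;> rcases hf01 x' y' with h' | h' <;> rw [h, h'] <;> norm_num
    simp only [habs, sum_add_distrib, sum_sub_distrib, ← mul_sum, ← sum_mul, sum_const,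
      nsmul_eq_mul]
    simp only [hf]
    rw [← he]
    ring
  have hright : ∑ x ∈ X, ∑ x' ∈ X, ∑ y ∈ Y, ∑ y' ∈ Y, (|f x y - f x' y| + |f x' y - f x' y'|) =
      (G.nbhdSpread Y X + G.nbhdSpread X Y) * (#X * #Y) := by
    have h1 : ∑ x ∈ X, ∑ x' ∈ X, ∑ y ∈ Y, ∑ y' ∈ Y, |f x y - f x' y| =
        #Y * ∑ x ∈ X, ∑ x' ∈ X, (G.nbhdDist Y x x' : ℝ) := by
      simp only [nbhdDist_eq_sum_abs, mul_sum, sum_const, nsmul_eq_mul, hf]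
    have h2 : ∑ x ∈ X, ∑ x' ∈ X, ∑ y ∈ Y, ∑ y' ∈ Y, |f x' y - f x' y'| =
        #X * ∑ y ∈ Y, ∑ y' ∈ Y, (G.nbhdDist X y y' : ℝ) := by
      rw [sum_const, nsmul_eq_mul, sum_comm]
      congr 1
      refine sum_congr rfl fun y _ => ?_
      rw [sum_comm]
      refine sum_congr rfl fun y' _ => ?_
      rw [nbhdDist_eq_sum_abs]
      refine sum_congr rfl fun x _ => ?_
      rw [hfsymm x y, hfsymm x y']
    simp only [sum_add_distrib]
    rw [h1, h2, nbhdSpread, nbhdSpread]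
    field_simp
  refine le_of_mul_le_mul_right ?_ (mul_pos hX' hY')
  rw [← hleft, ← hright]
  gcongr
  exact abs_sub_le _ _ _

theorem mul_card_mul_card_le_nbhdSpread {X Y : Finset V} (hX : X.Nonempty) (hY : Y.Nonempty)
    {ε : ℝ} (h : ¬ G.IsHomogeneousPair ε X Y) :
    2 * ε * (1 - ε) * (#X * #Y) ≤ G.nbhdSpread Y X + G.nbhdSpread X Y := by
  refine le_trans ?_ (edgeDensity_mul_one_sub_le_nbhdSpread hX hY)
  have h0 : (0 : ℝ) ≤ G.edgeDensity X Y := by exact_mod_cast G.edgeDensity_nonneg X Y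
  have h1 : (G.edgeDensity X Y : ℝ) ≤ 1 := by exact_mod_cast G.edgeDensity_le_one X Y
  simp only [IsHomogeneousPair, Set.mem_union, Set.mem_Ico, Set.mem_Ioc, h0, h1, true_and,
    and_true, not_or, not_lt] at h
  gcongr ?_ * _
  -- (d - ε)(1 - ε - d) ≥ 0 rearranges to d(1 - d) ≥ ε(1 - ε).
  nlinarith [mul_nonneg (sub_nonneg.2 h.1) (sub_nonneg.2 h.2)]

theorem nbhdSpread_nonneg (B X : Finset V) : 0 ≤ G.nbhdSpread B X := by
  unfold nbhdSpread
  positivity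

theorem isHomogeneousPair_comm {ε : ℝ} {X Y : Finset V} :
    G.IsHomogeneousPair ε X Y ↔ G.IsHomogeneousPair ε Y X := by
  rw [IsHomogeneousPair, IsHomogeneousPair, edgeDensity_comm]

theorem isHomogeneousPair_of_forall_not_adj {ε : ℝ} (hε : 0 < ε) {X Y : Finset V}
    (h : ∀ x ∈ X, ∀ y ∈ Y, ¬ G.Adj x y) : G.IsHomogeneousPair ε X Y := by
  have : G.interedges X Y = ∅ := by
    ext ⟨x, y⟩
    rw [mk_mem_interedges_iff]
    simp only [notMem_empty, iff_false]
    exact fun hxy => h x hxy.1 y hxy.2.1 hxy.2.2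
  left
  simp [edgeDensity_def, this, hε]

variable [DecidableEq V]

/-- `nbhdDist` is additive over disjoint reference sets, and the normalisation by |X| does not
involve them. -/
theorem sum_nbhdSpread_parts {B : Finset V} (Q : Finpartition B) (X : Finset V) :
    ∑ Y ∈ Q.parts, G.nbhdSpread Y X = G.nbhdSpread B X := by
  simp only [nbhdSpread]
  rw [← sum_div, sum_comm]
  congr 1
  refine sum_congr rfl fun x _ => ?_
  rw [sum_comm]
  refine sum_congr rfl fun x' _ => ?_
  simp only [nbhdDist_eq_sum_abs]
  conv_rhs => rw [← Q.biUnion_parts]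
  exact (sum_biUnion Q.disjoint).symm

/-- The total size of the inhomogeneous pairs of parts is controlled by the spreads. -/
theorem sum_card_mul_card_le_sum_nbhdSpread {A B : Finset V} (P : Finpartition A)
    (Q : Finpartition B) {ε : ℝ} {N : Finset (Finset V × Finset V)} (hN : N ⊆ P.parts ×ˢ Q.parts)
    (h : ∀ p ∈ N, ¬ G.IsHomogeneousPair ε p.1 p.2) :
    2 * ε * (1 - ε) * ∑ p ∈ N, ((#p.1 : ℝ) * #p.2) ≤
      ∑ X ∈ P.parts, G.nbhdSpread B X + ∑ Y ∈ Q.parts, G.nbhdSpread A Y := by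
  rw [mul_sum]
  calc _ ≤ ∑ p ∈ N, (G.nbhdSpread p.2 p.1 + G.nbhdSpread p.1 p.2) := by
        refine sum_le_sum fun p hp => ?_
        have hpN := mem_product.1 (hN hp)
        exact mul_card_mul_card_le_nbhdSpread (P.nonempty_of_mem_parts hpN.1)
          (Q.nonempty_of_mem_parts hpN.2) (h p hp)
    _ ≤ ∑ p ∈ P.parts ×ˢ Q.parts, (G.nbhdSpread p.2 p.1 + G.nbhdSpread p.1 p.2) :=
        sum_le_sum_of_subset_of_nonneg hN fun p _ _ =>
          add_nonneg (nbhdSpread_nonneg _ _) (nbhdSpread_nonneg _ _)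
    _ = _ := by
        rw [sum_add_distrib, sum_product, sum_product_right]
        simp only [sum_nbhdSpread_parts]

/-- For a bipartite graph, only pairs of parts from different sides can fail to be homogeneous. -/
theorem isHomogeneousPartition_disjUnion [Fintype V] {A B : Finset V} (hAB : A ∪ B = univ)
    (hG : G.IsBipartiteWith (A : Set V) (B : Set V)) (hdisj : Disjoint A B) (P : Finpartition A)
    (Q : Finpartition B) {ε : ℝ} (hε : 0 < ε)
    (h : ∀ N ⊆ P.parts ×ˢ Q.parts, (∀ p ∈ N, ¬ G.IsHomogeneousPair ε p.1 p.2) →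
      2 * ∑ p ∈ N, ((#p.1 : ℝ) * #p.2) ≤ ε * (Fintype.card V : ℝ) ^ 2) :
    G.IsHomogeneousPartition ε (P.disjUnion Q hdisj hAB) := by
  classical
  set R := P.disjUnion Q hdisj hAB with hR
  have hRparts : R.parts = P.parts ∪ Q.parts := rfl
  set N := {p ∈ P.parts ×ˢ Q.parts | ¬ G.IsHomogeneousPair ε p.1 p.2} with hN
  have hbound := h N (filter_subset _ _) fun p hp => (mem_filter.1 hp).2
  unfold IsHomogeneousPartition
  set T : Set (V × V) := {p | ∃ X ∈ R.parts, ∃ Y ∈ R.parts,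
    G.IsHomogeneousPair ε X Y ∧ p.1 ∈ X ∧ p.2 ∈ Y} with hT
  -- Two parts on the same side span no edges, so only cross pairs fail, each counted in both
  -- orders.
  have hcompl : Tᶜ ⊆ ((N.biUnion fun p => p.1 ×ˢ p.2) ∪ N.biUnion fun p => p.2 ×ˢ p.1 :
      Finset (V × V)) := by
    rintro ⟨x, y⟩ hxy
    obtain ⟨X, hX, hxX⟩ := R.exists_mem (mem_univ x)
    obtain ⟨Y, hY, hyY⟩ := R.exists_mem (mem_univ y)
    have hhom : ¬ G.IsHomogeneousPair ε X Y := fun hhom => hxy ⟨X, hX, Y, hY, hhom, hxX, hyY⟩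
    rw [mem_coe, mem_union]
    rw [hRparts, mem_union] at hX hY
    have hno : ∀ v, v ∈ A → v ∈ B → False := fun v hvA hvB =>
      Finset.disjoint_left.1 hdisj hvA hvB
    obtain hX | hX := hX <;> obtain hY | hY := hY
    · refine absurd (isHomogeneousPair_of_forall_not_adj hε fun x hx y hy hadj => ?_) hhom
      obtain h | h := hG.mem_of_adj hadj
      · exact hno y (P.subset hY hy) h.2
      · exact hno x (P.subset hX hx) h.1
    · left
      exact mem_biUnion.2 ⟨(X, Y), mem_filter.2 ⟨mem_product.2 ⟨hX, hY⟩, hhom⟩,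
        mem_product.2 ⟨hxX, hyY⟩⟩
    · right
      exact mem_biUnion.2 ⟨(Y, X), mem_filter.2 ⟨mem_product.2 ⟨hY, hX⟩,
        fun h => hhom (isHomogeneousPair_comm.1 h)⟩, mem_product.2 ⟨hxX, hyY⟩⟩
    · refine absurd (isHomogeneousPair_of_forall_not_adj hε fun x hx y hy hadj => ?_) hhom
      obtain h | h := hG.mem_of_adj hadj
      · exact hno x h.1 (Q.subset hX hx)
      · exact hno y h.2 (Q.subset hY hy)
  have hle : (Tᶜ.ncard : ℝ) ≤ 2 * ∑ p ∈ N, ((#p.1 : ℝ) * #p.2) := by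
    have h1 := Set.ncard_le_ncard hcompl (Finset.finite_toSet _)
    rw [Set.ncard_coe_finset] at h1
    have h2 : #((N.biUnion fun p => p.1 ×ˢ p.2) ∪ N.biUnion fun p => p.2 ×ˢ p.1) ≤
        ∑ p ∈ N, #p.1 * #p.2 + ∑ p ∈ N, #p.1 * #p.2 := by
      refine (card_union_le _ _).trans (add_le_add ?_ ?_)
      · exact card_biUnion_le.trans_eq (by simp only [card_product])
      · exact card_biUnion_le.trans_eq (by simp only [card_product, mul_comm])
    rw [two_mul]
    exact_mod_cast h1.trans h2
  have htotal : (T.ncard : ℝ) + Tᶜ.ncard = (Fintype.card V : ℝ) ^ 2 := by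
    have := Set.ncard_add_ncard_compl T
    rw [Nat.card_eq_fintype_card, Fintype.card_prod, ← sq] at this
    exact_mod_cast this
  linarith

end SimpleGraph

/-! ### Choice of parameters. -/

open SimpleGraph in
theorem theorem2p6 (k : ℕ) (hk : 1 ≤ k) :
    ∃ C : ℝ, 0 < C ∧ ∀ ε : ℝ, 0 < ε → ε < 1 / 4 →
      ∀ (V : Type*) [Fintype V] [DecidableEq V] (H : SimpleGraph V) [DecidableRel H.Adj]
        (A B : Finset V),
        A ∪ B = Finset.univ →
        H.IsBipartiteWith (A : Set V) (B : Set V) →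
        A.card = B.card →
        H.vcDimension < (k : ℕ∞) →
        ε⁻¹ ≤ (Fintype.card V : ℝ) →
        ∃ P : Finpartition (Finset.univ : Finset V),
          P.IsEquipartition ∧
          (∀ X ∈ P.parts, X ⊆ A ∨ X ⊆ B) ∧
          H.IsHomogeneousPartition ε P ∧
          ε⁻¹ ≤ (P.parts.card : ℝ) ∧
          (P.parts.card : ℝ) ≤ C * ε⁻¹ ^ (2 * k + 2) := by
  have hpc := one_le_packingConst hk
  -- There are at most 2t ≤ 4c^k/δ^(k+1) parts, where c is `packingConst k`; δ = ε²/2 turns this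
  -- into 2^(k+3) c^k ε^(-2k-2).
  refine ⟨packingConst k ^ k * 2 ^ (k + 3), by positivity, ?_⟩
  intro ε hε hε4 V _ _ H _ A B hAB hH hcard hvc hV
  have hdisj : Disjoint A B := by exact_mod_cast hH.disjoint
  have hVcard : Fintype.card V = 2 * #A := by
    rw [← card_univ, ← hAB, card_union_of_disjoint hdisj, ← hcard]
    omega
  have hVcard' : (Fintype.card V : ℝ) = 2 * #A := by exact_mod_cast hVcard
  have hApos : 0 < #A := by
    by_contra! h0
    rw [hVcard', Nat.le_zero.1 h0] at hV
    have := inv_pos.2 hε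
    norm_num at hV
    linarith
  have hA : A.Nonempty := card_pos.1 hApos
  have hB : B.Nonempty := card_pos.1 (hcard ▸ hApos)
  have hG := not_hasShatteredSet_of_vcDimension_lt hvc
  obtain ⟨δ, hδdef⟩ : ∃ δ : ℝ, δ = ε ^ 2 / 2 := ⟨_, rfl⟩
  have hδ : 0 < δ := by rw [hδdef]; positivity
  have hδ1 : δ ≤ 1 := by nlinarith
  have hbase : 1 ≤ packingConst k / δ := (one_le_div hδ).2 (hδ1.trans hpc)
  obtain ⟨t, htle, htlt⟩ : ∃ t : ℕ, (packingConst k / δ) ^ k / δ ≤ t ∧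
      (t : ℝ) < (packingConst k / δ) ^ k / δ + 1 :=
    ⟨_, Nat.le_ceil _, Nat.ceil_lt_add_one (by positivity)⟩
  have hδinv : δ⁻¹ ≤ (packingConst k / δ) ^ k / δ := by
    rw [div_eq_mul_inv _ δ]
    exact le_mul_of_one_le_left (by positivity) (one_le_pow₀ hbase)
  obtain ⟨P, hPcard, hPsize, hPsum⟩ :=
    exists_equitable_min_sum_nbhdSpread_le hk hG hA hB hδ hδ1 htle
  obtain ⟨Q, hQcard, hQsize, hQsum⟩ :=
    exists_equitable_min_sum_nbhdSpread_le hk hG hB hA hδ hδ1 htle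
  rw [← hcard] at hQcard hQsize hQsum hPsum
  have hRcard : (#(P.disjUnion Q hdisj hAB).parts : ℝ) = 2 * min (t : ℝ) #A := by
    rw [Finpartition.card_parts_disjUnion, hPcard, hQcard]
    push_cast
    ring
  refine ⟨P.disjUnion Q hdisj hAB, ?_, ?_, ?_, ?_, ?_⟩
  -- As |A| = |B|, both sides use the same two part sizes.
  · exact Set.equitableOn_iff_exists_eq_eq_add_one.2
      ⟨#A / min t #A, fun X hX => (mem_union.1 hX).elim (hPsize X) (hQsize X)⟩
  · exact fun X hX => (mem_union.1 hX).imp P.subset Q.subset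
  · refine isHomogeneousPartition_disjUnion hAB hH hdisj P Q hε fun N hN hNhom => ?_
    have hsum := sum_card_mul_card_le_sum_nbhdSpread P Q hN hNhom
    have hW : 0 ≤ ∑ p ∈ N, ((#p.1 : ℝ) * #p.2) :=
      sum_nonneg fun p _ => mul_nonneg (Nat.cast_nonneg _) (Nat.cast_nonneg _)
    generalize ∑ p ∈ N, ((#p.1 : ℝ) * #p.2) = W at hsum hW ⊢
    rw [hVcard']
    -- ε < 1/4 gives 2(1 - ε) ≥ 3/2, and 6δ = 3ε². Hence W ≤ 2ε|A|², that is 2W ≤ ε|V|².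
    have h1 : ε * (3 / 2 * W) ≤ ε * (3 * ε * (#A : ℝ) ^ 2) := by
      calc ε * (3 / 2 * W) ≤ 2 * ε * (1 - ε) * W := by
            nlinarith [mul_nonneg (mul_nonneg hε.le hW) (sub_nonneg.2 hε4.le)]
        _ ≤ 3 * δ * #A * #A + 3 * δ * #A * #A := hsum.trans (add_le_add hPsum hQsum)
        _ = _ := by rw [hδdef]; ring
    have h2 := le_of_mul_le_mul_left h1 hε
    linarith
  · rw [hRcard, mul_min_of_nonneg _ _ zero_le_two, ← hVcard']
    refine le_min ?_ hV
    have h1 : ε⁻¹ ≤ δ⁻¹ := inv_anti₀ hδ (by nlinarith)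
    have h2 : (0 : ℝ) ≤ t := by positivity
    linarith
  · rw [hRcard]
    have h1 : (t : ℝ) ≤ 2 * ((packingConst k / δ) ^ k / δ) := by
      have h3 : 1 ≤ δ⁻¹ := (one_le_inv₀ hδ).2 hδ1
      linarith
    calc 2 * min (t : ℝ) #A ≤ 2 * (2 * ((packingConst k / δ) ^ k / δ)) := by
          gcongr
          exact (min_le_left _ _).trans h1
      _ = _ := by
          rw [hδdef, div_pow, div_div, ← pow_succ, div_pow, ← pow_mul, pow_succ 2 (k + 2),
            pow_succ 2 (k + 1), inv_pow, show 2 * (k + 1) = 2 * k + 2 by ring, div_div_eq_mul_div]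
          ring
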